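/- Let $\mathbb{K}$ be a field and let $S$ be a finite monoid (for example a planar diagram monoid, or any finite monoid with trivial $\mathcal{H}$-classes). Let $\Phi\colon S\times S\to\mathbb{N}$ be a twisting, i.e. $\Phi(a,b)+\Phi(ab,c)=\Phi(a,bc)+\Phi(b,c)$ for all $a,b,c$, which is tight: for all $a,b\in S$ there are $a',b'\in S$ with $ab=a'b$, $\Phi(a',b)=0$ and $ab=ab'$, $\Phi(a,b')=0$. Let $M$ be a commutative monoid (written additively) all of whose $\mathcal{D}$-classes are singletons, and let $q\in M$. Let $T=M\times_\Phi^q S$ be the twisted product, i.e. the set $M\times S$ with $(j,a)(k,b)=(j+k+\Phi(a,b)q,\,ab)$, and let $T_\Phi^0=S\sqcup\{0\}$ be the $0$-twisted monoid, in which $a*b=ab$ if $a,b\in S$ and $\Phi(a,b)=0$, and $a*b=0$ otherwise (both are monoids because $\Phi$ is tight). Assume that for every $(j,a)\in T$ the following condition holds: if there is an idempotent $e$ in the $\mathcal{D}$-class of $a$ in $S$ with $\Phi(e,e)>0$ and $j=j+\Phi(e,e)q$, then $j=j+\Phi(f,f)q$ for all idempotents $f$ in that $\mathcal{D}$-class with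 $\Phi(f,f)>0$. An apex of a monoid $A$ is a $\mathcal{J}$-class of $A$ containing an idempotent (equivalently, with nonzero Gram matrix). A simple $\mathbb{K}$-linear $A$-module has apex $J$ if the elements of $A$ acting nontrivially on it are exactly those lying $\mathcal{J}$-above $J$. For $j\in M$, the layer of $T$ over $j$ consists of the isomorphism classes of simple $T$-modules whose apex is the class of some $(j,a)$, $a\in S$. Then, layer by layer, $T$ has the same indexing set and the same dimensions for its simple modules as $S$ or as its $0$-twisted version: 1. For every idempotent $j\in M$ at least one of the following holds. (a) For all $a\in S$, the class of $(j,a)$ is an apex of $T$ if and only if the class of $a$ is an apex of $S$; and there is a dimension-preserving bijection from the layer of $T$ over $j$ to the set of isomorphism classes of simple $S$-modules, under which a simple $T$-module has as apex the class of $(j,a)$ if and only if the corresponding simple $S$-module has as apex the class of $a$. (b) The same with $S$ replaced by $T_\Phi^0$, where the simple $T_\Phi^0$-modules with apex $\{0\}$ are discarded. 2. If the class of $(j,a)$ is an apex of $T$, or if the layer of $T$ over $j$ is nonempty, then $j$ is idempotent. 3. If $M$ is finite, then every simple $T$-module lies in exactly one layer. 4. If $S$ has trivial $\mathcal{H}$-classes,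 then sending a simple module to its apex is a bijection from isomorphism classes of simple modules to apexes for $S$ and for $T_\Phi^0$, and, if $M$ is finite, also for $T$. -/

import Mathlib

universe u v w

namespace TwistedMonoid

/-! ### Green's relations of a monoid -/

section Green

variable {A : Type v} [Monoid A]

/-- `a ≤_R b`. -/
def LeR (a b : A) : Prop := ∃ y, a = b * y

/-- `a ≤_L b`. -/
def LeL (a b : A) : Prop := ∃ x, a = x * b

/-- `a ≤_J b`. -/
def LeJ (a b : A) : Prop := ∃ x y, a = x * b * y

/-- Green's relation `R`. -/
def GreenR (a b : A) : Prop := LeR a b ∧ LeR b a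

/-- Green's relation `L`. -/
def GreenL (a b : A) : Prop := LeL a b ∧ LeL b a

/-- Green's relation `H = L ∩ R`. -/
def GreenH (a b : A) : Prop := GreenL a b ∧ GreenR a b

/-- Green's relation `D = L ∘ R` (which equals `R ∘ L`). -/
def GreenD (a b : A) : Prop := ∃ c, GreenL a c ∧ GreenR c b

/-- Green's relation `J`. -/
def GreenJ (a b : A) : Prop := LeJ a b ∧ LeJ b a

theorem LeJ.refl (a : A) : LeJ a a := ⟨1, 1, by simp⟩

theorem LeJ.trans {a b c : A} (h : LeJ a b) (h' : LeJ b c) : LeJ a c := by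
  obtain ⟨x, y, rfl⟩ := h
  obtain ⟨x', y', rfl⟩ := h'
  exact ⟨x * x', y' * y, by simp only [mul_assoc]⟩

variable (A)

/-- All `H`-classes of `A` are singletons. -/
def HTrivial : Prop := ∀ a b : A, GreenH a b → a = b

/-- All `D`-classes of `A` are singletons. -/
def DTrivial : Prop := ∀ a b : A, GreenD a b → a = b

/-- The equivalence relation `J` on `A`. -/
def greenJSetoid : Setoid A where
  r := GreenJ
  iseqv :=
    { refl := fun a => ⟨LeJ.refl a, LeJ.refl a⟩
      symm := fun h => ⟨h.2, h.1⟩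
      trans := fun h h' => ⟨h.1.trans h'.1, h'.2.trans h.2⟩ }

/-- The set of `J`-classes (two-sided cells) of `A`. -/
def JClass : Type v := Quotient (greenJSetoid A)

variable {A}

/-- The `J`-class of an element. -/
def jClass (a : A) : JClass A := Quotient.mk (greenJSetoid A) a

/-- A `J`-class is an apex if it contains an idempotent, that is, if its Gram matrix, whose entries
record which `H`-classes of the `J`-class contain an idempotent, is not the zero matrix. -/
def JClass.IsApex (J : JClass A) : Prop := ∃ e : A, e * e = e ∧ jClass e = J

end Green

/-! ### Simple modules of a monoid over a field -/

/-- A simple `K`-linear representation of the monoid `A`. -/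
structure Irrep (K : Type u) [Field K] (A : Type v) [Monoid A] where
  /-- The underlying vector space. -/
  V : Type u
  [addCommGroup : AddCommGroup V]
  [module : Module K V]
  /-- The action of `A`. -/
  ρ : Representation K A V
  irreducible : ρ.IsIrreducible

attribute [instance] Irrep.addCommGroup Irrep.module

section Irreps

variable (K : Type u) [Field K] (A : Type v) [Monoid A]

/-- Isomorphism of simple representations. -/
def irrepSetoid : Setoid (Irrep K A) where
  r X Y := Nonempty (Representation.Equiv X.ρ Y.ρ)
  iseqv :=
    { refl := fun X => ⟨Representation.Equiv.refl X.ρ⟩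
      symm := fun ⟨e⟩ => ⟨e.symm⟩
      trans := fun ⟨e⟩ ⟨f⟩ => ⟨e.trans f⟩ }

/-- The set of isomorphism classes of simple `K`-linear representations of `A`. -/
def IrrepClass : Type (max (u + 1) v) := Quotient (irrepSetoid K A)

variable {K A}

/-- The dimension over `K` of (the members of) an isomorphism class of simple representations. -/
noncomputable def IrrepClass.dim (X : IrrepClass K A) : Cardinal.{u} :=
  Quotient.lift (s := irrepSetoid K A) (fun Y => Module.rank K Y.V)
    (fun _ _ ⟨e⟩ => e.toLinearEquiv.rank_eq) X

/-- `J` is the apex of the simple representation `X`: the elements of `A` that do not act by zero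
are exactly those that lie `J`-above `J`. In other words, `J` is the least `J`-class that does not
annihilate `X`. -/
def Irrep.HasApex (X : Irrep K A) (J : JClass A) : Prop :=
  ∃ a : A, jClass a = J ∧ ∀ x : A, X.ρ x ≠ 0 ↔ LeJ a x

/-- `J` is the apex of the members of the isomorphism class `X`. -/
def IrrepClass.HasApex (X : IrrepClass K A) (J : JClass A) : Prop :=
  ∃ Y : Irrep K A, Quotient.mk (irrepSetoid K A) Y = X ∧ Y.HasApex J

variable (K A)

/-- The set of apexes is an indexing set for the simple `A`-modules: sending a simple module to
its apex is a bijection from isomorphism classes to `J`-classes that contain an idempotent. -/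
def IndexedByApexes : Prop :=
  ∃ F : IrrepClass K A ≃ {J : JClass A // J.IsApex},
    ∀ X : IrrepClass K A, X.HasApex (F X)

end Irreps

/-! ### Twistings -/

/-- A twisting of a semigroup `S`. -/
structure Twisting (S : Type v) [Semigroup S] where
  /-- The underlying map. -/
  Φ : S → S → ℕ
  cocycle : ∀ a b c : S, Φ a b + Φ (a * b) c = Φ a (b * c) + Φ b c

/-- Tightness of a twisting. -/
class Twisting.IsTight {S : Type v} [Semigroup S] (t : Twisting S) : Prop where
  left : ∀ a b : S, ∃ a' : S, a * b = a' * b ∧ t.Φ a' b = 0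
  right : ∀ a b : S, ∃ b' : S, a * b = a * b' ∧ t.Φ a b' = 0

theorem Twisting.map_one_right {S : Type v} [Monoid S] (t : Twisting S) [t.IsTight] (a : S) :
    t.Φ a 1 = 0 := by
  obtain ⟨a', h, h'⟩ := Twisting.IsTight.left (t := t) a 1
  simp only [mul_one] at h
  rw [h, h']

theorem Twisting.map_one_left {S : Type v} [Monoid S] (t : Twisting S) [t.IsTight] (a : S) :
    t.Φ 1 a = 0 := by
  obtain ⟨a', h, h'⟩ := Twisting.IsTight.right (t := t) 1 a
  simp only [one_mul] at h
  rw [h, h']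

/-! ### Twisted products -/

/-- The underlying set `M × S` of the twisted product of `M` and `S` along `t` and `q`. -/
@[ext] structure TwistedProduct {S : Type v} [Semigroup S] (t : Twisting S)
    {M : Type w} [AddCommMonoid M] (q : M) where
  /-- The component in `M`. -/
  fst : M
  /-- The component in `S`. -/
  snd : S

/-- The product `(j, a) (k, b) = (j + k + Φ(a, b) q, a b)`. -/
instance {S : Type v} [Semigroup S] (t : Twisting S) {M : Type w} [AddCommMonoid M] (q : M) :
    Semigroup (TwistedProduct t q) where
  mul x y := ⟨x.fst + y.fst + t.Φ x.snd y.snd • q, x.snd * y.snd⟩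
  mul_assoc x y z := by
    refine TwistedProduct.ext ?_ (mul_assoc x.snd y.snd z.snd)
    change x.fst + y.fst + t.Φ x.snd y.snd • q + z.fst + t.Φ (x.snd * y.snd) z.snd • q
      = x.fst + (y.fst + z.fst + t.Φ y.snd z.snd • q) + t.Φ x.snd (y.snd * z.snd) • q
    have h := congrArg (fun n : ℕ => n • q) (t.cocycle x.snd y.snd z.snd)
    simp only [add_smul] at h
    calc _ = x.fst + y.fst + z.fst + (t.Φ x.snd y.snd • q + t.Φ (x.snd * y.snd) z.snd • q) := by
          abel
      _ = _ := by rw [h]; abel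

/-- If `S` is a monoid and the twisting is tight, then `(0, 1)` is an identity element. -/
instance {S : Type v} [Monoid S] (t : Twisting S) [t.IsTight] {M : Type w} [AddCommMonoid M]
    (q : M) : Monoid (TwistedProduct t q) where
  one := ⟨0, 1⟩
  one_mul x := by
    refine TwistedProduct.ext ?_ (one_mul x.snd)
    change 0 + x.fst + t.Φ 1 x.snd • q = x.fst
    simp [t.map_one_left]
  mul_one x := by
    refine TwistedProduct.ext ?_ (mul_one x.snd)
    change x.fst + 0 + t.Φ x.snd 1 • q = x.fst
    simp [t.map_one_right]

/-! ### The 0-twisted semigroup -/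

/-- The underlying set `S ⊔ {0}` of the 0-twisted semigroup of `S` and `t`. -/
inductive ZeroTwisted {S : Type v} [Semigroup S] (t : Twisting S) : Type v
  | zero : ZeroTwisted t
  | of (a : S) : ZeroTwisted t

namespace ZeroTwisted

variable {S : Type v}

/-- `a * b = a b` if `Φ(a, b) = 0`, and `a * b = 0` otherwise. -/
protected def mul [Semigroup S] {t : Twisting S} : ZeroTwisted t → ZeroTwisted t → ZeroTwisted t
  | of a, of b => if t.Φ a b = 0 then of (a * b) else zero
  | of _, zero => zero
  | zero, _ => zero

instance [Semigroup S] (t : Twisting S) : SemigroupWithZero (ZeroTwisted t) where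
  mul := ZeroTwisted.mul
  zero := zero
  zero_mul _ := rfl
  mul_zero x := by cases x <;> rfl
  mul_assoc x y z := by
    change ZeroTwisted.mul (ZeroTwisted.mul x y) z = ZeroTwisted.mul x (ZeroTwisted.mul y z)
    cases x <;> cases y <;> cases z <;> simp only [ZeroTwisted.mul]
    · split_ifs <;> rfl
    · rename_i a b c
      have h := t.cocycle a b c
      by_cases h1 : t.Φ a b = 0 <;> by_cases h2 : t.Φ b c = 0 <;>
        simp only [h1, h2, if_true, if_false, mul_assoc]
      · have h3 : t.Φ (a * b) c = t.Φ a (b * c) := by omega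
        rw [h3]
      · rw [if_neg (by omega)]
      · rw [if_neg (by omega)]

/-- If `S` is a monoid and the twisting is tight, then the identity of `S` is an identity. -/
instance [Monoid S] (t : Twisting S) [t.IsTight] : MonoidWithZero (ZeroTwisted t) where
  one := of 1
  one_mul x := by
    change ZeroTwisted.mul (of 1) x = x
    cases x <;> simp [ZeroTwisted.mul, t.map_one_left]
  mul_one x := by
    change ZeroTwisted.mul x (of 1) = x
    cases x <;> simp [ZeroTwisted.mul, t.map_one_right]
  zero_mul := zero_mul
  mul_zero := mul_zero

end ZeroTwisted

/-- The condition on the `D`-class of `(j, a)` in the twisted product: if some idempotent `e` of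
the `D`-class of `a` in `S` satisfies `Φ(e, e) > 0` and `j = j + Φ(e, e) q`, then every idempotent
`f` of that `D`-class with `Φ(f, f) > 0` satisfies `j = j + Φ(f, f) q`. -/
def ExistsImpliesForAll {S : Type v} [Monoid S] (t : Twisting S) {M : Type w} [AddCommMonoid M]
    (q j : M) (a : S) : Prop :=
  (∃ e : S, e * e = e ∧ GreenD e a ∧ 0 < t.Φ e e ∧ j = j + t.Φ e e • q) →
    ∀ f : S, f * f = f → GreenD f a → 0 < t.Φ f f → j = j + t.Φ f f • q

/-- The simple module class `X` of the twisted product lies in the layer `j`: its apex is the class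
of some `(j, a)`. -/
def InLayer {K : Type u} [Field K] {S : Type v} [Monoid S] {t : Twisting S} [t.IsTight]
    {M : Type w} [AddCommMonoid M] {q : M} (j : M) (X : IrrepClass K (TwistedProduct t q)) : Prop :=
  ∃ a : S, X.HasApex (jClass ⟨j, a⟩)

end TwistedMonoid

/-! Since `D`-classes of `M` are singletons, divisibility in `M` is antisymmetric. A regular element
of the twisted product therefore has an idempotent first coordinate, and an idempotent `j` absorbs
each summand of any expression for `j`. So the layer over an idempotent `j` depends only on when `j
+ Φ(a, b) q = j`. If `j + q = j`, this always holds and the layer multiplies like `S`. Otherwise it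
holds exactly when `Φ(a, b) = 0`, and the layer multiplies like the 0-twisted monoid.
`IsLayerMonoid` treats both cases at once.

For modules, `(j, 1)` is a central idempotent acting as the identity on every simple module of the
layer, so `(k, b)` acts as `(j, b)` if `j` absorbs `k`, and as zero otherwise. The action thus
factors through the layer monoid on the same vector space; conversely, simple modules of that monoid
killing `Z` inflate (`exists_layerRel_of_inLayer`, `exists_layerRel_of_map_eq_zero`). Apexes match
by `IsLayerMonoid.leJ_iff`.

The indexing by apexes is the Clifford–Munn–Ponizovskii theorem with trivial maximal subgroups:
existence comes from a maximal left ideal (`exists_irrep_hasApex`), uniqueness from comparing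
annihilators of cyclic vectors (`equiv_of_apex`). -/

namespace TwistedMonoid

/-! ### Regularity and stability in finite monoids -/

section Green

variable {A : Type v} [Monoid A]

theorem jClass_eq_iff {a b : A} : jClass a = jClass b ↔ LeJ a b ∧ LeJ b a :=
  Quotient.eq (r := greenJSetoid A)

theorem JClass.isApex_iff {a : A} : (jClass a).IsApex ↔ ∃ e : A, e * e = e ∧ LeJ e a ∧ LeJ a e := by
  simp only [JClass.IsApex, jClass_eq_iff]

theorem eq_pow_mul_mul_pow {a u w : A} (h : a = u * a * w) (n : ℕ) : a = u ^ n * a * w ^ n := by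
  induction n with
  | zero => simp
  | succ n ih =>
    calc a = u * (u ^ n * a * w ^ n) * w := by rw [← ih, ← h]
      _ = _ := by rw [pow_succ', pow_succ]; simp only [mul_assoc]

/-- Powers of `w` are eventually periodic by pigeonhole. The exponent is kept positive so that a
factor `w` can be split off later. -/
theorem exists_pow_mul_self_eq [Finite A] (w : A) :
    ∃ n : ℕ, w ^ (n + 1) * w ^ (n + 1) = w ^ (n + 1) := by
  obtain ⟨m, n, hmn, h⟩ := Finite.exists_ne_map_eq_of_infinite (fun n : ℕ => w ^ n)
  wlog hlt : m < n generalizing m n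
  · exact this n m hmn.symm h.symm (by omega)
  obtain ⟨d, rfl⟩ := Nat.exists_eq_add_of_lt hlt
  -- `w ^ k` is periodic with period `d + 1` from `k = m` on
  have key : ∀ c : ℕ, ∀ k, m ≤ k → w ^ (k + c * (d + 1)) = w ^ k := by
    intro c
    induction c with
    | zero => simp
    | succ c ih =>
      intro k hk
      obtain ⟨l, rfl⟩ := Nat.exists_eq_add_of_le hk
      calc w ^ (m + l + (c + 1) * (d + 1)) = w ^ (m + d + 1) * w ^ (l + c * (d + 1)) := by
            rw [← pow_add]; congr 1; ring
        _ = w ^ (m + l + c * (d + 1)) := by rw [← h, ← pow_add]; congr 1; ring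
        _ = _ := ih _ hk
  -- The exponent `(m + 1) * (d + 1)` is a multiple of the period and at least the preperiod `m`.
  refine ⟨(m + 1) * (d + 1) - 1, ?_⟩
  have hpos : 0 < (m + 1) * (d + 1) := by positivity
  rw [Nat.sub_add_cancel hpos, ← pow_add]
  exact key _ _ (by nlinarith)

/-- If `a x a` lies `J`-above `a` for some `x`, then the `J`-class of `a` is regular. -/
theorem isApex_of_leJ_mul_mul [Finite A] {a x : A} (h : LeJ a (a * x * a)) :
    (jClass a).IsApex := by
  obtain ⟨u, v, h⟩ := h
  -- An idempotent power of `x a v` contains the factor `a`, and iterating this equation makes it a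
  -- factor of `a`.
  have h' : a = u * a * (x * a * v) := by simpa only [mul_assoc] using h
  obtain ⟨n, hn⟩ := exists_pow_mul_self_eq (x * a * v)
  exact JClass.isApex_iff.2 ⟨_, hn, ⟨(x * a * v) ^ n * x, v, by simp only [pow_succ, mul_assoc]⟩,
    ⟨u ^ (n + 1) * a, 1, by rw [mul_one]; exact eq_pow_mul_mul_pow h' (n + 1)⟩⟩

/-- A version of stability for finite monoids with trivial `H`-classes. -/
theorem mul_mul_eq_of_leJ [Finite A] (hA : HTrivial A) {e x : A} (he : e * e = e)
    (h : LeJ e (e * x * e)) : e * x * e = e := by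
  obtain ⟨u, v, h⟩ := h
  set g := e * x * e with hg
  have heg : e * g = g := by rw [hg]; simp only [← mul_assoc, he]
  have hge : g * e = g := by rw [hg]; simp only [mul_assoc, he]
  refine hA _ _ ⟨⟨⟨e * x, hg⟩, ?_⟩, ⟨⟨x * e, by rw [hg, mul_assoc]⟩, ?_⟩⟩
  -- An idempotent power `f` of `u g` is a left factor of `e`, so `f e = e`; it ends in `g = g e`,
  -- so `f e = f`. Hence `e = f` is a left multiple of `g`. The other half is dual.
  · have h1 : e = (u * g) * e * v := by rw [mul_assoc u g e, hge]; exact h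
    obtain ⟨n, hn⟩ := exists_pow_mul_self_eq (u * g)
    have h2 := eq_pow_mul_mul_pow h1 (n + 1)
    set f := (u * g) ^ (n + 1) with hf
    have hfe : f * e = f := by rw [hf, pow_succ]; simp only [mul_assoc, hge]
    have hfe' : f * e = e := by
      conv_lhs => rw [h2]
      rw [← mul_assoc, ← mul_assoc, hn, ← h2]
    exact ⟨(u * g) ^ n * u, by rw [mul_assoc, ← pow_succ, ← hf, ← hfe, hfe']⟩
  · have h1 : e = u * e * (g * v) := by
      rw [mul_assoc u e, ← mul_assoc e g v, heg, ← mul_assoc]; exact h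
    obtain ⟨n, hn⟩ := exists_pow_mul_self_eq (g * v)
    have h2 := eq_pow_mul_mul_pow h1 (n + 1)
    set f := (g * v) ^ (n + 1) with hf
    have hfe : e * f = f := by rw [hf, pow_succ']; simp only [← mul_assoc, heg]
    have hfe' : e * f = e := by
      conv_lhs => rw [h2]
      rw [mul_assoc, hn, ← h2]
    exact ⟨v * (g * v) ^ n, by rw [← mul_assoc, ← pow_succ', ← hf, ← hfe, hfe']⟩

end Green

/-! ### Simple representations and their apexes -/

section Irreducible

variable {K : Type u} [Field K] {A : Type v} [Monoid A] {V : Type w} [AddCommGroup V] [Module K V]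

theorem isIrreducible_iff (ρ : Representation K A V) :
    ρ.IsIrreducible ↔ Nontrivial V ∧
      ∀ N : Submodule K V, (∀ g, ∀ v ∈ N, ρ g v ∈ N) → N = ⊥ ∨ N = ⊤ := by
  constructor
  · intro h
    refine ⟨?_, fun N hN => ?_⟩
    · by_contra hV
      rw [not_nontrivial_iff_subsingleton] at hV
      apply bot_ne_top (α := Subrepresentation ρ)
      exact Subrepresentation.toSubmodule_injective (Subsingleton.elim _ _)
    · exact (h.eq_bot_or_eq_top ⟨N, fun g v hv => hN g v hv⟩).imp
        (congrArg Subrepresentation.toSubmodule) (congrArg Subrepresentation.toSubmodule)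
  · rintro ⟨_, h⟩
    exact
      { exists_pair_ne := ⟨⊥, ⊤, fun h' => bot_ne_top (α := Submodule K V)
          (congrArg Subrepresentation.toSubmodule h')⟩
        eq_bot_or_eq_top := fun N =>
          (h N.toSubmodule fun g v hv => N.apply_mem_toSubmodule g hv).imp
            (fun h' => Subrepresentation.toSubmodule_injective h')
            (fun h' => Subrepresentation.toSubmodule_injective h') }

/-- Irreducibility depends only on the set of nonzero operators. -/
theorem isIrreducible_of_operators {B : Type*} [Monoid B] {ρ : Representation K A V}
    (hρ : ρ.IsIrreducible) (σ : Representation K B V) (h : ∀ a, ρ a = 0 ∨ ∃ b, σ b = ρ a) :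
    σ.IsIrreducible := by
  rw [isIrreducible_iff] at hρ ⊢
  refine ⟨hρ.1, fun N hN => hρ.2 N fun a v hv => ?_⟩
  rcases h a with h | ⟨b, h⟩
  · simp [h]
  · rw [← h]; exact hN b v hv

theorem isIrreducible_conj {W : Type*} [AddCommGroup W] [Module K W] {ρ : Representation K A V}
    (hρ : ρ.IsIrreducible) (σ : Representation K A W) (e : V ≃ₗ[K] W)
    (h : ∀ a v, e (ρ a v) = σ a (e v)) : σ.IsIrreducible := by
  rw [isIrreducible_iff] at hρ ⊢
  have := hρ.1
  refine ⟨e.symm.toEquiv.nontrivial, fun N hN => ?_⟩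
  refine (hρ.2 (N.comap e.toLinearMap) fun a v hv => ?_).imp (fun h' => ?_) (fun h' => ?_)
  · simp only [Submodule.mem_comap, LinearEquiv.coe_coe, h] at hv ⊢
    exact hN a _ hv
  · exact Submodule.comap_injective_of_surjective e.surjective
      (h'.trans (LinearMap.ker_eq_bot.2 e.injective).symm)
  · exact Submodule.comap_injective_of_surjective e.surjective (h'.trans (Submodule.comap_top _).symm)

theorem span_orbit_eq_top {ρ : Representation K A V} (hρ : ρ.IsIrreducible) {v : V} (hv : v ≠ 0) :
    Submodule.span K (Set.range fun a => ρ a v) = ⊤ := by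
  refine (((isIrreducible_iff ρ).1 hρ).2 _ fun g w hw => ?_).resolve_left fun h => hv ?_
  · have : Submodule.span K (Set.range fun a => ρ a v) ≤
        (Submodule.span K (Set.range fun a => ρ a v)).comap (ρ g) := by
      rw [Submodule.span_le]
      rintro _ ⟨a, rfl⟩
      refine Submodule.subset_span ⟨g * a, ?_⟩
      simp
    exact this hw
  · rw [Submodule.span_eq_bot] at h
    exact h v ⟨1, by simp⟩

theorem exists_apply_ne_zero {ρ : Representation K A V} (hρ : ρ.IsIrreducible) {v : V} (hv : v ≠ 0)
    {b : A} (hb : ρ b ≠ 0) : ∃ s, ρ b (ρ s v) ≠ 0 := by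
  by_contra! h
  refine hb (LinearMap.ker_eq_top.1 (top_le_iff.1 ?_))
  rw [← span_orbit_eq_top hρ hv, Submodule.span_le]
  rintro _ ⟨s, rfl⟩
  exact h s

/-- The annihilating elements behave like a prime ideal. This yields both the existence of apexes
and their regularity. -/
theorem exists_mul_mul_ne_zero {ρ : Representation K A V} (hρ : ρ.IsIrreducible)
    {a b : A} (ha : ρ a ≠ 0) (hb : ρ b ≠ 0) : ∃ s, ρ (b * s * a) ≠ 0 := by
  obtain ⟨v, hv⟩ := DFunLike.ne_iff.1 ha
  obtain ⟨s, hs⟩ := exists_apply_ne_zero hρ hv hb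
  exact ⟨s, fun h => hs (by simpa using congr($h v))⟩

theorem ne_zero_of_leJ {ρ : Representation K A V} {a x : A} (ha : ρ a ≠ 0) (h : LeJ a x) :
    ρ x ≠ 0 := by
  obtain ⟨y, z, rfl⟩ := h
  intro hx
  simp [hx] at ha

theorem map_one_ne_zero {ρ : Representation K A V} (hρ : ρ.IsIrreducible) : ρ 1 ≠ 0 := by
  have := ((isIrreducible_iff ρ).1 hρ).1
  rw [map_one]
  exact one_ne_zero

/-- A simple representation of a finite monoid has an apex. -/
theorem exists_apex [Finite A] {ρ : Representation K A V} (hρ : ρ.IsIrreducible) :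
    ∃ a, ∀ x, ρ x ≠ 0 ↔ LeJ a x := by
  let _ : Preorder A :=
    { le := LeJ
      le_refl := LeJ.refl
      le_trans := fun _ _ _ => LeJ.trans }
  obtain ⟨a, ha⟩ := (Set.toFinite {a | ρ a ≠ 0}).exists_minimal ⟨1, map_one_ne_zero hρ⟩
  refine ⟨a, fun x => ⟨fun hx => ?_, ne_zero_of_leJ ha.prop⟩⟩
  -- The element `x s a` acts nontrivially and lies below the minimal `a`, hence also above it.
  obtain ⟨s, hs⟩ := exists_mul_mul_ne_zero hρ ha.prop hx
  have h1 : LeJ a (x * s * a) := ha.le_of_le hs ⟨x * s, 1, by simp⟩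
  exact h1.trans ⟨1, s * a, by simp [mul_assoc]⟩

end Irreducible

/-! ### Apexes of isomorphism classes -/

section Classes

variable {K : Type u} [Field K] {A : Type v} [Monoid A]

/-- The isomorphism class of a simple representation. -/
def irrepClass (X : Irrep K A) : IrrepClass K A := Quotient.mk (irrepSetoid K A) X

theorem IrrepClass.exists_rep (X : IrrepClass K A) : ∃ Y, irrepClass Y = X :=
  Quotient.exists_rep X

theorem irrepClass_eq_iff {X Y : Irrep K A} : irrepClass X = irrepClass Y ↔
    ∃ e : X.V ≃ₗ[K] Y.V, ∀ a v, e (X.ρ a v) = Y.ρ a (e v) := by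
  refine (Quotient.eq (r := irrepSetoid K A)).trans ⟨fun ⟨e⟩ => ⟨e.toLinearEquiv, fun a v => ?_⟩,
    fun ⟨e, h⟩ => ⟨Representation.Equiv.mk e fun a => LinearMap.ext (h a)⟩⟩
  exact congr($(e.toIntertwiningMap.isIntertwining' a) v)

theorem apply_eq_zero_iff_of_conj {V W : Type*} [AddCommGroup V] [Module K V]
    [AddCommGroup W] [Module K W] (e : V ≃ₗ[K] W) {f : Module.End K V} {g : Module.End K W}
    (h : ∀ v, e (f v) = g (e v)) : f = 0 ↔ g = 0 := by
  constructor
  · rintro rfl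
    ext w
    simpa using (h (e.symm w)).symm
  · rintro rfl
    ext v
    simpa using h v

theorem Irrep.hasApex_jClass_iff {X : Irrep K A} {a : A} :
    X.HasApex (jClass a) ↔ ∀ x, X.ρ x ≠ 0 ↔ LeJ a x := by
  refine ⟨fun ⟨b, hb, h⟩ x => (h x).trans ?_, fun h => ⟨a, rfl, h⟩⟩
  rw [jClass_eq_iff] at hb
  exact ⟨hb.2.trans, hb.1.trans⟩

theorem IrrepClass.hasApex_iff {X : Irrep K A} {a : A} :
    (irrepClass X).HasApex (jClass a) ↔ ∀ x, X.ρ x ≠ 0 ↔ LeJ a x := by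
  refine ⟨fun ⟨Y, hY, h⟩ x => ?_, fun h => ⟨X, rfl, Irrep.hasApex_jClass_iff.2 h⟩⟩
  rw [← Irrep.hasApex_jClass_iff.1 h x]
  obtain ⟨e, he⟩ := irrepClass_eq_iff.1 hY
  exact (apply_eq_zero_iff_of_conj e (he x)).not.symm

theorem IrrepClass.HasApex.unique {X : IrrepClass K A} {J J' : JClass A} (h : X.HasApex J)
    (h' : X.HasApex J') : J = J' := by
  obtain ⟨X, rfl⟩ := X.exists_rep
  obtain ⟨a, rfl⟩ := Quotient.exists_rep J
  obtain ⟨b, rfl⟩ := Quotient.exists_rep J'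
  have ha := IrrepClass.hasApex_iff.1 h
  have hb := IrrepClass.hasApex_iff.1 h'
  exact jClass_eq_iff.2 ⟨(ha b).1 ((hb b).2 (LeJ.refl b)), (hb a).1 ((ha a).2 (LeJ.refl a))⟩

theorem IrrepClass.exists_hasApex [Finite A] (X : IrrepClass K A) :
    ∃ a, X.HasApex (jClass a) := by
  obtain ⟨X, rfl⟩ := X.exists_rep
  obtain ⟨a, ha⟩ := exists_apex X.irreducible
  exact ⟨a, IrrepClass.hasApex_iff.2 ha⟩

theorem IrrepClass.HasApex.exists_leJ {X : IrrepClass K A} {a : A} (h : X.HasApex (jClass a)) :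
    ∃ x, LeJ a (a * x * a) := by
  obtain ⟨X, rfl⟩ := X.exists_rep
  have ha := IrrepClass.hasApex_iff.1 h
  have h0 := (ha a).2 (LeJ.refl a)
  obtain ⟨s, hs⟩ := exists_mul_mul_ne_zero X.irreducible h0 h0
  exact ⟨s, (ha _).1 hs⟩

end Classes

end TwistedMonoid

namespace TwistedMonoid

open scoped MonoidAlgebra

/-! ### Indexing by apexes for trivial `H`-classes -/

section HTrivial

variable {K : Type u} [Field K] {A : Type v} [Monoid A]

/-- The left ideal of those `r` for which `r e` is supported on elements that do not lie `J`-above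
`e`. -/
noncomputable def nonaboveIdeal (K : Type u) [Field K] {A : Type v} [Monoid A] (e : A) :
    Ideal K[A] where
  carrier := {r : K[A] | ∀ x, LeJ e x → (r * MonoidAlgebra.single e (1 : K)).coeff x = 0}
  zero_mem' := by simp
  add_mem' := by
    intro r s hr hs x hx
    rw [add_mul, MonoidAlgebra.coeff_add, Finsupp.add_apply, hr x hx, hs x hx, add_zero]
  smul_mem' := by
    classical
    intro r s hs x hx
    rw [smul_eq_mul, mul_assoc, MonoidAlgebra.coeff_mul]
    refine Finset.sum_eq_zero fun a _ => Finset.sum_eq_zero fun b _ => ?_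
    dsimp only
    split_ifs with h
    -- If `x = a b` lies above `e`, so does its factor `b`, where the coefficient already vanishes.
    · rw [hs b (hx.trans ⟨a, 1, by simp [h]⟩), mul_zero]
    · rfl

theorem nonaboveIdeal_ne_top (K : Type u) [Field K] (e : A) : nonaboveIdeal K e ≠ ⊤ := by
  intro h
  have : (1 : K[A]) ∈ nonaboveIdeal K e := by rw [h]; trivial
  have := this e (LeJ.refl e)
  rw [one_mul, MonoidAlgebra.coeff_single, Finsupp.single_eq_same] at this
  exact one_ne_zero this

theorem single_mem_nonaboveIdeal (K : Type u) [Field K] {e x : A} (hx : ¬ LeJ e x) :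
    MonoidAlgebra.single x 1 ∈ nonaboveIdeal K e := by
  intro y hy
  rw [MonoidAlgebra.single_mul_single, MonoidAlgebra.coeff_single, Finsupp.single_eq_of_ne]
  rintro rfl
  exact hx (hy.trans ⟨1, e, by simp⟩)

theorem one_sub_mem_nonaboveIdeal (K : Type u) [Field K] {e : A} (he : e * e = e) :
    1 - MonoidAlgebra.single e 1 ∈ nonaboveIdeal K e := by
  intro y _
  rw [sub_mul, one_mul, MonoidAlgebra.single_mul_single, he, mul_one, sub_self]
  rfl

/-- A simple module over the monoid algebra of a finite monoid, as a simple representation. -/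
theorem exists_irrep_of_isSimpleModule [Finite A] (W : Type w) [AddCommGroup W] [Module K W]
    [Module K[A] W] [IsScalarTower K K[A] W] [IsSimpleModule K[A] W] :
    ∃ (X : Irrep K A) (E : W ≃ₗ[K] X.V),
      ∀ a w, X.ρ a (E w) = E (MonoidAlgebra.single a (1 : K) • w) := by
  have : Module.Finite K K[A] := Module.Finite.equiv (MonoidAlgebra.coeffLinearEquiv K).symm
  have : Module.Finite K W := Module.Finite.trans K[A] W
  let ρ : Representation K A W := Representation.ofModule' W
  have hρ : ∀ a w, ρ a w = MonoidAlgebra.single a (1 : K) • w := fun _ _ => rfl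
  have hirr : ρ.IsIrreducible := by
    rw [isIrreducible_iff]
    refine ⟨IsSimpleModule.nontrivial K[A] W, fun N hN => ?_⟩
    let N' : Submodule K[A] W :=
      { N with
        smul_mem' := by
          intro r v hv
          induction r using MonoidAlgebra.induction_linear with
          | zero => rw [zero_smul]; exact N.zero_mem
          | add x y hx hy => rw [add_smul]; exact N.add_mem hx hy
          | single a k =>
            have : MonoidAlgebra.single a k = k • MonoidAlgebra.single a (1 : K) := by simp
            rw [this, smul_assoc]
            exact N.smul_mem _ (hN a v hv) }
    refine (eq_bot_or_eq_top N').imp (fun h => ?_) (fun h => ?_)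
    · ext v
      exact (Submodule.ext_iff.1 h v :)
    · ext v
      exact (Submodule.ext_iff.1 h v :)
  -- Coordinates move the module into the universe of `K`, as `Irrep` requires.
  let E : W ≃ₗ[K] (Fin (Module.finrank K W) → K) := (Module.finBasis K W).equivFun
  let σ : Representation K A (Fin (Module.finrank K W) → K) :=
    (E.conjAlgEquiv K : Module.End K W →* Module.End K (Fin (Module.finrank K W) → K)).comp ρ
  have hσ : ∀ a w, E (ρ a w) = σ a (E w) := by
    intro a w
    simp [σ, LinearEquiv.conjAlgEquiv_apply]
  exact ⟨⟨_, σ, isIrreducible_conj hirr σ E hσ⟩, E, fun a w => by rw [← hρ, hσ]⟩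

/-- In the quotient by a maximal left ideal containing `nonaboveIdeal K e`, the image of `1` is
fixed by `e`. If `x` is not above `e`, neither is any `x s`, so `x` kills the whole orbit of this
cyclic vector. -/
theorem exists_irrep_hasApex [Finite A] {e : A} (he : e * e = e) :
    ∃ X : Irrep K A, ∀ x, X.ρ x ≠ 0 ↔ LeJ e x := by
  obtain ⟨m, hm, hle⟩ := Ideal.exists_le_maximal _ (nonaboveIdeal_ne_top K e)
  have : IsSimpleModule K[A] (K[A] ⧸ m) := isSimpleModule_iff_isCoatom.2 hm.out
  obtain ⟨X, E, hE⟩ := exists_irrep_of_isSimpleModule (K := K) (A := A) (K[A] ⧸ m)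
  have hX : ∀ a (r : K[A]), X.ρ a (E (Submodule.Quotient.mk r)) =
      E (Submodule.Quotient.mk (MonoidAlgebra.single a 1 * r)) := fun a r => hE a _
  -- `e` fixes the image of `1`
  have h1 : X.ρ e ≠ 0 := by
    intro h
    have h2 := hX e 1
    rw [h, LinearMap.zero_apply, mul_one, eq_comm, LinearEquiv.map_eq_zero_iff,
      Submodule.Quotient.mk_eq_zero] at h2
    refine hm.ne_top ((Ideal.eq_top_iff_one m).2 ?_)
    simpa using m.add_mem (hle (one_sub_mem_nonaboveIdeal K he)) h2
  refine ⟨X, fun x => ⟨fun hx => ?_, ne_zero_of_leJ h1⟩⟩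
  have hv : E (Submodule.Quotient.mk 1) ≠ 0 := by
    intro h
    rw [LinearEquiv.map_eq_zero_iff, Submodule.Quotient.mk_eq_zero] at h
    exact hm.ne_top ((Ideal.eq_top_iff_one m).2 h)
  obtain ⟨s, hs⟩ := exists_apply_ne_zero X.irreducible hv hx
  by_contra hex
  apply hs
  rw [hX, hX, LinearEquiv.map_eq_zero_iff, Submodule.Quotient.mk_eq_zero, mul_one,
    MonoidAlgebra.single_mul_single, mul_one]
  exact hle (single_mem_nonaboveIdeal K fun h => hex (h.trans ⟨1, s, by simp⟩))

/-- By `hA`, for `v` fixed by `e`, each `e s x e` sends `v` to `v` or `0` according to the `J`-order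
alone. By irreducibility `r v = 0` exactly when `e s r v = 0` for all `s`, so the annihilator of `v`
depends only on `A` and `e`, and it determines the module. -/
theorem equiv_of_apex {e : A} (he : e * e = e) (hA : ∀ x, LeJ e (e * x * e) → e * x * e = e)
    {X Y : Irrep K A} (hX : ∀ x, X.ρ x ≠ 0 ↔ LeJ e x) (hY : ∀ x, Y.ρ x ≠ 0 ↔ LeJ e x) :
    irrepClass X = irrepClass Y := by
  classical
  -- a cyclic vector of each representation has the same annihilator
  have key : ∀ X : Irrep K A, (∀ x, X.ρ x ≠ 0 ↔ LeJ e x) → ∃ f : K[A] →ₗ[K] X.V,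
      Function.Surjective f ∧ (∀ a r, f (MonoidAlgebra.single a 1 * r) = X.ρ a (f r)) ∧
      ∀ r, f r = 0 ↔ ∀ s : A,
        Finsupp.linearCombination K (fun x => if LeJ e (e * s * x * e) then (1 : K) else 0)
          r.coeff = 0 := by
    clear hX hY X Y
    intro X hX
    obtain ⟨w, hw⟩ := DFunLike.ne_iff.1 ((hX e).2 (LeJ.refl e))
    obtain ⟨v, hv⟩ : ∃ v, v = X.ρ e w := ⟨_, rfl⟩
    rw [← hv, LinearMap.zero_apply] at hw
    have hev : X.ρ e v = v := by
      rw [hv, ← Module.End.mul_apply, ← map_mul, he]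
    refine ⟨(LinearMap.applyₗ v) ∘ₗ X.ρ.asAlgebraHom.toLinearMap, ?_, ?_, ?_⟩
    · rw [← LinearMap.range_eq_top, ← top_le_iff, ← span_orbit_eq_top X.irreducible hw,
        Submodule.span_le]
      rintro _ ⟨a, rfl⟩
      exact ⟨MonoidAlgebra.single a 1, by simp⟩
    · intro a r
      simp
    · intro r
      have h1 : ∀ s, X.ρ e (X.ρ s (X.ρ.asAlgebraHom r v)) = (Finsupp.linearCombination K
          (fun x => if LeJ e (e * s * x * e) then (1 : K) else 0) r.coeff) • v := by
        intro s
        induction r using MonoidAlgebra.induction_linear with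
        | zero => simp
        | add x y hx hy => simp [add_smul, hx, hy]
        | single a k =>
          have h2 : X.ρ (e * s * a * e) v = if LeJ e (e * s * a * e) then v else 0 := by
            split_ifs with h
            · rw [mul_assoc e s a] at h ⊢
              rw [hA _ h, hev]
            · rw [← hX, not_not] at h
              rw [h, LinearMap.zero_apply]
          simp only [map_mul, Module.End.mul_apply, hev] at h2
          simp [h2]
      constructor
      · intro h s
        have := h1 s
        simp only [LinearMap.coe_comp, Function.comp_apply, AlgHom.toLinearMap_apply,
          LinearMap.applyₗ_apply_apply] at h
        rw [h, map_zero, map_zero] at this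
        exact (smul_eq_zero.1 this.symm).resolve_right hw
      · intro h
        by_contra h'
        obtain ⟨s, hs⟩ := exists_apply_ne_zero X.irreducible h' ((hX e).2 (LeJ.refl e))
        apply hs
        have := h1 s
        rw [h s, zero_smul] at this
        exact this
  obtain ⟨f, hf, hfa, hf0⟩ := key X hX
  obtain ⟨g, hg, hga, hg0⟩ := key Y hY
  have hker : f.ker = g.ker := by
    ext r
    rw [LinearMap.mem_ker, LinearMap.mem_ker, hf0, hg0]
  obtain ⟨E, hE⟩ : ∃ E : X.V ≃ₗ[K] Y.V, ∀ r, E (f r) = g r := by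
    refine ⟨(f.quotKerEquivOfSurjective hf).symm ≪≫ₗ Submodule.quotEquivOfEq _ _ hker ≪≫ₗ
      g.quotKerEquivOfSurjective hg, fun r => ?_⟩
    have : (f.quotKerEquivOfSurjective hf).symm (f r) = Submodule.Quotient.mk r := by
      rw [LinearEquiv.symm_apply_eq]; rfl
    simp only [LinearEquiv.trans_apply, this, Submodule.quotEquivOfEq_mk]
    rfl
  refine irrepClass_eq_iff.2 ⟨E, fun a v => ?_⟩
  obtain ⟨r, rfl⟩ := hf v
  rw [← hfa, hE, hga, hE]

/-- The simple representations of a finite monoid with trivial `H`-classes are indexed by its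
apexes. -/
theorem indexedByApexes_of_hTrivial (K : Type u) [Field K] [Finite A] (hA : HTrivial A) :
    IndexedByApexes K A := by
  have h1 : ∀ X : IrrepClass K A, ∃ J : {J : JClass A // J.IsApex}, X.HasApex J := by
    intro X
    obtain ⟨a, ha⟩ := X.exists_hasApex
    obtain ⟨x, hx⟩ := ha.exists_leJ
    exact ⟨⟨jClass a, isApex_of_leJ_mul_mul hx⟩, ha⟩
  choose F hF using h1
  refine ⟨Equiv.ofBijective F ⟨fun X Y hXY => ?_, fun ⟨J, e, he, hJ⟩ => ?_⟩, hF⟩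
  · obtain ⟨e, he, hJ⟩ := (F X).2
    have hX := hF X
    have hY := hF Y
    rw [← hXY, ← hJ] at hY
    rw [← hJ] at hX
    obtain ⟨X, rfl⟩ := X.exists_rep
    obtain ⟨Y, rfl⟩ := Y.exists_rep
    exact equiv_of_apex he (fun x => mul_mul_eq_of_leJ hA he) (IrrepClass.hasApex_iff.1 hX)
      (IrrepClass.hasApex_iff.1 hY)
  · obtain ⟨X, hX⟩ := exists_irrep_hasApex (K := K) he
    refine ⟨irrepClass X, Subtype.ext ((hF _).unique ?_)⟩
    subst hJ
    exact IrrepClass.hasApex_iff.2 hX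

end HTrivial

end TwistedMonoid

namespace TwistedMonoid

/-! ### Absorption in `M` -/

section Divisibility

variable {M : Type w} [AddCommMonoid M]

/-- If the `D`-classes of `M` are singletons, then divisibility in `M` is antisymmetric. -/
theorem eq_of_dvd_of_dvd (hM : DTrivial (Multiplicative M)) {a b x y : M} (h : a = b + x)
    (h' : b = a + y) : a = b := by
  have h1 : a = x + b := by rw [h, add_comm]
  have h2 : b = y + a := by rw [h', add_comm]
  exact hM (.ofAdd a) (.ofAdd b) ⟨.ofAdd b, ⟨⟨.ofAdd x, h1⟩, ⟨.ofAdd y, h2⟩⟩,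
    ⟨⟨1, (mul_one _).symm⟩, ⟨1, (mul_one _).symm⟩⟩⟩

theorem add_eq_self_of_eq_add (hM : DTrivial (Multiplicative M)) {j s t : M} (hj : j + j = j)
    (h : j = s + t) : j + s = j :=
  eq_of_dvd_of_dvd hM (x := s) (y := t) rfl (by rw [add_assoc, ← h, hj])

theorem add_eq_self_of_add_add_eq_self (hM : DTrivial (Multiplicative M)) {j s t : M}
    (h : j + (s + t) = j) : j + s = j :=
  eq_of_dvd_of_dvd hM (x := s) (y := t) rfl (by rw [add_assoc, h])

end Divisibility

/-! ### First coordinates in the twisted product -/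

section TwistedProduct

variable {S : Type v} [Monoid S] {t : Twisting S} [t.IsTight] {M : Type w} [AddCommMonoid M]
  {q : M}

theorem TwistedProduct.mk_mul_mk (j k : M) (a b : S) :
    (⟨j, a⟩ * ⟨k, b⟩ : TwistedProduct t q) = ⟨j + k + t.Φ a b • q, a * b⟩ := rfl

theorem TwistedProduct.one_def : (1 : TwistedProduct t q) = ⟨0, 1⟩ := rfl

theorem TwistedProduct.fst_mul (x y : TwistedProduct t q) :
    (x * y).fst = x.fst + y.fst + t.Φ x.snd y.snd • q := rfl

theorem TwistedProduct.exists_fst_eq_of_leJ {x y : TwistedProduct t q} (h : LeJ x y) :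
    ∃ s, x.fst = y.fst + s := by
  obtain ⟨c, d, rfl⟩ := h
  refine ⟨c.fst + t.Φ c.snd y.snd • q + d.fst + t.Φ (c * y).snd d.snd • q, ?_⟩
  rw [fst_mul, fst_mul]
  abel

theorem TwistedProduct.fst_eq_of_leJ (hM : DTrivial (Multiplicative M)) {x y : TwistedProduct t q}
    (h : LeJ x y) (h' : LeJ y x) : x.fst = y.fst := by
  obtain ⟨s, hs⟩ := exists_fst_eq_of_leJ h
  obtain ⟨s', hs'⟩ := exists_fst_eq_of_leJ h'
  exact eq_of_dvd_of_dvd hM hs hs'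

/-- The first coordinate of `x y x` contains that of `x` twice, so `x.fst` and `x.fst + x.fst`
divide each other. -/
theorem TwistedProduct.add_fst_self_of_leJ_mul_mul (hM : DTrivial (Multiplicative M))
    {x y : TwistedProduct t q} (h : LeJ x (x * y * x)) : x.fst + x.fst = x.fst := by
  obtain ⟨s, hs⟩ := exists_fst_eq_of_leJ h
  rw [fst_mul, fst_mul] at hs
  refine eq_of_dvd_of_dvd hM (x := x.fst)
    (y := y.fst + t.Φ x.snd y.snd • q + t.Φ (x * y).snd x.snd • q + s) rfl ?_
  nth_rw 1 [hs]
  abel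

theorem TwistedProduct.add_self_of_isApex (hM : DTrivial (Multiplicative M)) {j : M} {a : S}
    (h : (jClass (⟨j, a⟩ : TwistedProduct t q)).IsApex) : j + j = j := by
  obtain ⟨e, he, h1, h2⟩ := JClass.isApex_iff.1 h
  have h3 : e.fst = j := fst_eq_of_leJ hM h1 h2
  rw [← h3]
  exact add_fst_self_of_leJ_mul_mul hM (y := e) (by rw [he, he]; exact LeJ.refl e)

theorem InLayer.add_self {K : Type u} [Field K] (hM : DTrivial (Multiplicative M)) {j : M}
    {X : IrrepClass K (TwistedProduct t q)} (h : InLayer j X) : j + j = j := by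
  obtain ⟨a, ha⟩ := h
  obtain ⟨x, hx⟩ := ha.exists_leJ
  exact TwistedProduct.add_fst_self_of_leJ_mul_mul hM hx

theorem InLayer.unique {K : Type u} [Field K] (hM : DTrivial (Multiplicative M)) {j k : M}
    {X : IrrepClass K (TwistedProduct t q)} (h : InLayer j X) (h' : InLayer k X) : j = k := by
  obtain ⟨a, ha⟩ := h
  obtain ⟨b, hb⟩ := h'
  obtain ⟨h1, h2⟩ := jClass_eq_iff.1 (ha.unique hb)
  exact TwistedProduct.fst_eq_of_leJ hM h1 h2

theorem exists_inLayer {K : Type u} [Field K] [Finite (TwistedProduct t q)]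
    (X : IrrepClass K (TwistedProduct t q)) : ∃ j : M, InLayer j X := by
  obtain ⟨⟨j, a⟩, h⟩ := X.exists_hasApex
  exact ⟨j, a, h⟩

instance [Finite S] [Finite M] : Finite (TwistedProduct t q) :=
  Finite.of_injective (fun x => (x.fst, x.snd)) fun _ _ h =>
    TwistedProduct.ext (congrArg Prod.fst h) (congrArg Prod.snd h)

theorem TwistedProduct.hTrivial (hM : DTrivial (Multiplicative M)) (hS : HTrivial S) :
    HTrivial (TwistedProduct t q) := by
  rintro _ _ ⟨⟨⟨a, ha⟩, ⟨b, hb⟩⟩, ⟨⟨c, hc⟩, ⟨d, hd⟩⟩⟩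
  exact TwistedProduct.ext
    (fst_eq_of_leJ hM ⟨a, 1, by rw [mul_one, ha]⟩ ⟨b, 1, by rw [mul_one, hb]⟩)
    (hS _ _ ⟨⟨⟨a.snd, congrArg snd ha⟩, ⟨b.snd, congrArg snd hb⟩⟩,
      ⟨⟨c.snd, congrArg snd hc⟩, ⟨d.snd, congrArg snd hd⟩⟩⟩)

end TwistedProduct

/-! ### The 0-twisted monoid -/

section ZeroTwisted

theorem ZeroTwisted.of_injective {S : Type v} [Semigroup S] {t : Twisting S} :
    Function.Injective (of : S → ZeroTwisted t) :=
  fun _ _ => ZeroTwisted.of.inj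

variable {S : Type v} [Monoid S] {t : Twisting S} [t.IsTight]

theorem ZeroTwisted.of_mul_of (a b : S) :
    (of a * of b : ZeroTwisted t) = if t.Φ a b = 0 then of (a * b) else 0 := rfl

theorem ZeroTwisted.eq_zero_or_eq_of (x : ZeroTwisted t) : x = 0 ∨ ∃ a, x = of a := by
  cases x with
  | zero => exact .inl rfl
  | of a => exact .inr ⟨a, rfl⟩

theorem ZeroTwisted.of_ne_zero (a : S) : (of a : ZeroTwisted t) ≠ 0 := fun h => by cases h

instance [Finite S] : Finite (ZeroTwisted t) :=
  Finite.of_surjective (fun x : Option S => x.elim 0 ZeroTwisted.of) fun x => by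
    rcases x.eq_zero_or_eq_of with rfl | ⟨a, rfl⟩
    · exact ⟨none, rfl⟩
    · exact ⟨some a, rfl⟩

theorem ZeroTwisted.exists_eq_mul_of_of_eq_mul {a b : S} {x : ZeroTwisted t}
    (h : of a = x * of b) : ∃ c, a = c * b := by
  rcases x.eq_zero_or_eq_of with rfl | ⟨c, rfl⟩
  · rw [zero_mul] at h
    exact (of_ne_zero a h).elim
  · rw [of_mul_of] at h
    split_ifs at h
    exact ⟨c, of_injective h⟩

theorem ZeroTwisted.exists_eq_mul_of_of_eq_mul' {a b : S} {x : ZeroTwisted t}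
    (h : of a = of b * x) : ∃ c, a = b * c := by
  rcases x.eq_zero_or_eq_of with rfl | ⟨c, rfl⟩
  · rw [mul_zero] at h
    exact (of_ne_zero a h).elim
  · rw [of_mul_of] at h
    split_ifs at h
    exact ⟨c, of_injective h⟩

theorem ZeroTwisted.hTrivial (hS : HTrivial S) : HTrivial (ZeroTwisted t) := by
  rintro x y ⟨⟨⟨a, ha⟩, ⟨b, hb⟩⟩, ⟨⟨c, hc⟩, ⟨d, hd⟩⟩⟩
  rcases x.eq_zero_or_eq_of with rfl | ⟨x, rfl⟩
  · rw [hb, mul_zero]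
  rcases y.eq_zero_or_eq_of with rfl | ⟨y, rfl⟩
  · rw [ha, mul_zero]
  exact congrArg of (hS _ _ ⟨⟨exists_eq_mul_of_of_eq_mul ha, exists_eq_mul_of_of_eq_mul hb⟩,
    ⟨exists_eq_mul_of_of_eq_mul' hc, exists_eq_mul_of_of_eq_mul' hd⟩⟩)

theorem not_hasApex_zero_iff {K : Type u} [Field K] {A : Type v} [MonoidWithZero A]
    {X : Irrep K A} : ¬ (irrepClass X).HasApex (jClass 0) ↔ X.ρ 0 = 0 := by
  rw [IrrepClass.hasApex_iff, ← not_iff_comm]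
  have h0 : ∀ x : A, LeJ 0 x := fun x => ⟨0, 0, by simp⟩
  exact ⟨fun h x => ⟨fun _ => h0 x, ne_zero_of_leJ h⟩, fun h => (h 0).2 (h0 0)⟩

end ZeroTwisted

/-! ### Layers over an idempotent of `M` -/

section Layer

/-- `B` is the monoid that governs the layer of the twisted product over the idempotent `j`:
it is `S`, with some products possibly moved to an ideal `Z`. -/
structure IsLayerMonoid {S : Type v} [Monoid S] (t : Twisting S) {M : Type w} [AddCommMonoid M]
    (q j : M) {B : Type v} [Monoid B] (φ : S → B) (Z : Set B) : Prop where
  injective : Function.Injective φ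
  map_one : φ 1 = 1
  mem_or : ∀ b, b ∈ Z ∨ ∃ a, b = φ a
  notMem : ∀ a, φ a ∉ Z
  mul_mem_left : ∀ z ∈ Z, ∀ b, b * z ∈ Z
  mul_mem_right : ∀ z ∈ Z, ∀ b, z * b ∈ Z
  map_mul : ∀ a b, j + t.Φ a b • q = j → φ (a * b) = φ a * φ b
  mul_mem : ∀ a b, j + t.Φ a b • q ≠ j → φ a * φ b ∈ Z

variable {K : Type u} [Field K] {S : Type v} [Monoid S] {t : Twisting S} {M : Type w}
  [AddCommMonoid M] {q j : M} {B : Type v} [Monoid B] {φ : S → B} {Z : Set B}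

theorem isLayerMonoid_self (hj : j + q = j) :
    IsLayerMonoid t q j (id : S → S) ∅ where
  injective := Function.injective_id
  map_one := rfl
  mem_or b := .inr ⟨b, rfl⟩
  notMem _ := id
  mul_mem_left _ h := h.elim
  mul_mem_right _ h := h.elim
  map_mul _ _ _ := rfl
  mul_mem a b h := by
    refine (h ?_).elim
    generalize t.Φ a b = n
    induction n with
    | zero => simp
    | succ n ih => rw [succ_nsmul, ← add_assoc, ih, hj]

/-- If `j` absorbed a positive multiple of `q`, it would absorb the summand `q`. -/
theorem isLayerMonoid_zeroTwisted [t.IsTight] (hM : DTrivial (Multiplicative M)) (hj : j + q ≠ j) :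
    IsLayerMonoid t q j (ZeroTwisted.of : S → ZeroTwisted t) {0} where
  injective := ZeroTwisted.of_injective
  map_one := rfl
  mem_or := ZeroTwisted.eq_zero_or_eq_of
  notMem := ZeroTwisted.of_ne_zero
  mul_mem_left := by rintro _ rfl b; exact mul_zero b
  mul_mem_right := by rintro _ rfl b; exact zero_mul b
  map_mul a b h := by
    rw [ZeroTwisted.of_mul_of, if_pos]
    by_contra h'
    obtain ⟨n, hn⟩ := Nat.exists_eq_succ_of_ne_zero h'
    rw [hn, succ_nsmul'] at h
    exact hj (add_eq_self_of_add_add_eq_self hM h)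
  mul_mem a b h := by
    rw [ZeroTwisted.of_mul_of, if_neg]
    · rfl
    · intro h'
      simp [h'] at h

namespace IsLayerMonoid

theorem notMem_of_leJ (hB : IsLayerMonoid t q j φ Z) {a : S} {b : B} (h : LeJ (φ a) b) :
    b ∉ Z := by
  intro hb
  obtain ⟨x, y, h⟩ := h
  exact hB.notMem a (h ▸ hB.mul_mem_right _ (hB.mul_mem_left _ hb x) y)

theorem add_eq_self_of_mul_notMem (hB : IsLayerMonoid t q j φ Z) {a b : S}
    (h : φ a * φ b ∉ Z) : j + t.Φ a b • q = j := by
  by_contra h'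
  exact h (hB.mul_mem a b h')

variable [t.IsTight]

/-- In a factorization of `(j, a)` through `(k, b)`, every contribution to the first coordinate is a
summand of `j`, hence absorbed; so no product falls into `Z`. Conversely, factors avoiding `Z` lift
with first coordinate `j`. -/
theorem leJ_iff (hB : IsLayerMonoid t q j φ Z) (hM : DTrivial (Multiplicative M)) (hj : j + j = j)
    {k : M} {a b : S} :
    LeJ (⟨j, a⟩ : TwistedProduct t q) ⟨k, b⟩ ↔ j + k = j ∧ LeJ (φ a) (φ b) := by
  constructor
  · rintro ⟨⟨x, c⟩, ⟨y, d⟩, h⟩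
    have h1 : j = x + k + t.Φ c b • q + y + t.Φ (c * b) d • q := congrArg TwistedProduct.fst h
    have h2 : a = c * b * d := congrArg TwistedProduct.snd h
    have hk : j + k = j := add_eq_self_of_eq_add hM hj
      (t := x + t.Φ c b • q + y + t.Φ (c * b) d • q) (by nth_rw 1 [h1]; abel)
    have hcb : j + t.Φ c b • q = j := add_eq_self_of_eq_add hM hj
      (t := x + k + y + t.Φ (c * b) d • q) (by nth_rw 1 [h1]; abel)
    have hcbd : j + t.Φ (c * b) d • q = j := add_eq_self_of_eq_add hM hj
      (t := x + k + t.Φ c b • q + y) (by nth_rw 1 [h1]; abel)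
    exact ⟨hk, φ c, φ d, by rw [h2, hB.map_mul _ _ hcbd, hB.map_mul _ _ hcb]⟩
  · rintro ⟨hk, x, y, h⟩
    have hx : x ∉ Z := fun hx => hB.notMem a
      (h ▸ hB.mul_mem_right _ (hB.mul_mem_right _ hx _) _)
    have hy : y ∉ Z := fun hy => hB.notMem a (h ▸ hB.mul_mem_left _ hy _)
    obtain ⟨c, rfl⟩ := (hB.mem_or x).resolve_left hx
    obtain ⟨d, rfl⟩ := (hB.mem_or y).resolve_left hy
    have hcb : j + t.Φ c b • q = j := hB.add_eq_self_of_mul_notMem fun h' =>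
      hB.notMem a (h ▸ hB.mul_mem_right _ h' _)
    rw [← hB.map_mul _ _ hcb] at h
    have hcbd : j + t.Φ (c * b) d • q = j := hB.add_eq_self_of_mul_notMem fun h' =>
      hB.notMem a (h ▸ h')
    rw [← hB.map_mul _ _ hcbd] at h
    refine ⟨⟨j, c⟩, ⟨j, d⟩, TwistedProduct.ext ?_ (hB.injective h)⟩
    change j = j + k + t.Φ c b • q + j + t.Φ (c * b) d • q
    rw [hk, hcb, hj, hcbd]

theorem isApex_iff (hB : IsLayerMonoid t q j φ Z) (hM : DTrivial (Multiplicative M))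
    (hj : j + j = j) (a : S) :
    (jClass (⟨j, a⟩ : TwistedProduct t q)).IsApex ↔ (jClass (φ a)).IsApex := by
  rw [JClass.isApex_iff, JClass.isApex_iff]
  constructor
  · rintro ⟨⟨k, e⟩, he, h1, h2⟩
    obtain rfl : k = j := TwistedProduct.fst_eq_of_leJ hM h1 h2
    have h3 : k + k + t.Φ e e • q = k := congrArg TwistedProduct.fst he
    have h4 : e * e = e := congrArg TwistedProduct.snd he
    rw [hj] at h3
    exact ⟨φ e, by rw [← hB.map_mul _ _ h3, h4], ((hB.leJ_iff hM hj).1 h1).2,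
      ((hB.leJ_iff hM hj).1 h2).2⟩
  · rintro ⟨f, hf, h1, h2⟩
    obtain ⟨e, rfl⟩ := (hB.mem_or f).resolve_left (hB.notMem_of_leJ h2)
    have h3 : j + t.Φ e e • q = j := hB.add_eq_self_of_mul_notMem (by rw [hf]; exact hB.notMem e)
    rw [← hB.map_mul _ _ h3] at hf
    refine ⟨⟨j, e⟩, TwistedProduct.ext ?_ (hB.injective hf), (hB.leJ_iff hM hj).2 ⟨hj, h1⟩,
      (hB.leJ_iff hM hj).2 ⟨hj, h2⟩⟩
    change j + j + t.Φ e e • q = j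
    rw [hj, h3]

end IsLayerMonoid

variable [t.IsTight]

open Classical in
/-- The simple representations `X` of the twisted product and `Y` of the monoid of its layer `j`
correspond to each other. -/
def LayerRel (j : M) (φ : S → B) (Z : Set B) (X : Irrep K (TwistedProduct t q)) (Y : Irrep K B) :
    Prop :=
  (∀ z ∈ Z, Y.ρ z = 0) ∧ ∃ e : X.V ≃ₗ[K] Y.V, ∀ k b v,
    e (X.ρ ⟨k, b⟩ v) = if j + k = j then Y.ρ (φ b) (e v) else 0

theorem LayerRel.hasApex_iff (hB : IsLayerMonoid t q j φ Z) (hM : DTrivial (Multiplicative M))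
    (hj : j + j = j) {X : Irrep K (TwistedProduct t q)} {Y : Irrep K B} (h : LayerRel j φ Z X Y)
    (a : S) : (irrepClass X).HasApex (jClass ⟨j, a⟩) ↔ (irrepClass Y).HasApex (jClass (φ a)) := by
  classical
  obtain ⟨hZ, e, he⟩ := h
  have h1 : ∀ k b, X.ρ ⟨k, b⟩ ≠ 0 ↔ j + k = j ∧ Y.ρ (φ b) ≠ 0 := by
    intro k b
    by_cases hk : j + k = j
    · simp only [hk, true_and]
      exact (apply_eq_zero_iff_of_conj e fun v => by rw [he, if_pos hk]).not
    · simp only [hk, false_and, iff_false, not_not]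
      exact (apply_eq_zero_iff_of_conj (g := 0) e fun v => by rw [he, if_neg hk]; rfl).2 rfl
  rw [IrrepClass.hasApex_iff, IrrepClass.hasApex_iff]
  constructor
  · intro h b
    by_cases hb : b ∈ Z
    · exact iff_of_false (not_not.2 (hZ b hb)) fun h' => hB.notMem_of_leJ h' hb
    · obtain ⟨s, rfl⟩ := (hB.mem_or b).resolve_left hb
      simpa only [h1, hB.leJ_iff hM hj, hj, true_and] using h ⟨j, s⟩
  · rintro h ⟨k, b⟩
    rw [h1, hB.leJ_iff hM hj, h]

theorem LayerRel.dim_eq {X : Irrep K (TwistedProduct t q)} {Y : Irrep K B}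
    (h : LayerRel j φ Z X Y) : (irrepClass Y).dim = (irrepClass X).dim := by
  obtain ⟨-, e, -⟩ := h
  exact e.rank_eq.symm

theorem LayerRel.irrepClass_eq_iff (hB : IsLayerMonoid t q j φ Z) (hj : j + j = j)
    {X X' : Irrep K (TwistedProduct t q)} {Y Y' : Irrep K B} (h : LayerRel j φ Z X Y)
    (h' : LayerRel j φ Z X' Y') : irrepClass X = irrepClass X' ↔ irrepClass Y = irrepClass Y' := by
  classical
  obtain ⟨hZ, e, he⟩ := h
  obtain ⟨hZ', e', he'⟩ := h'
  rw [TwistedMonoid.irrepClass_eq_iff, TwistedMonoid.irrepClass_eq_iff]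
  constructor
  · rintro ⟨f, hf⟩
    refine ⟨e.symm ≪≫ₗ f ≪≫ₗ e', fun b v => ?_⟩
    obtain ⟨v, rfl⟩ := e.surjective v
    by_cases hb : b ∈ Z
    · simp [hZ b hb, hZ' b hb]
    · obtain ⟨s, rfl⟩ := (hB.mem_or b).resolve_left hb
      have h1 := he j s v
      have h2 := he' j s (f v)
      rw [if_pos hj] at h1 h2
      simp [← h1, ← h2, hf]
  · rintro ⟨f, hf⟩
    refine ⟨e ≪≫ₗ f ≪≫ₗ e'.symm, fun ⟨k, b⟩ v => ?_⟩
    apply e'.injective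
    simp only [LinearEquiv.trans_apply, LinearEquiv.apply_symm_apply, he, he']
    split_ifs
    · rw [hf]
    · rw [map_zero]

/-- The space is kept, `φ s` acts as `(j, s)`, and `Z` acts as zero. -/
theorem exists_layerRel_of_inLayer (hB : IsLayerMonoid t q j φ Z)
    (hM : DTrivial (Multiplicative M)) (hj : j + j = j) {X : Irrep K (TwistedProduct t q)}
    (h : InLayer j (irrepClass X)) : ∃ Y : Irrep K B, LayerRel j φ Z X Y := by
  classical
  obtain ⟨a, ha⟩ := h
  rw [IrrepClass.hasApex_iff] at ha
  have hne : ∀ k b, X.ρ ⟨k, b⟩ ≠ 0 → j + k = j := fun k b h => ((hB.leJ_iff hM hj).1 ((ha _).1 h)).1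
  have hmul : ∀ k b, X.ρ ⟨j, 1⟩ * X.ρ ⟨k, b⟩ = X.ρ ⟨j + k, b⟩ := fun k b => by
    rw [← map_mul, TwistedProduct.mk_mul_mk, t.map_one_left]; simp
  have hmul' : ∀ k b, X.ρ ⟨k, b⟩ * X.ρ ⟨j, 1⟩ = X.ρ ⟨j + k, b⟩ := fun k b => by
    rw [← map_mul, TwistedProduct.mk_mul_mk, t.map_one_right]; simp [add_comm]
  -- the central idempotent `(j, 1)` acts as the identity
  have hone : X.ρ ⟨j, 1⟩ = 1 := by
    have h1 : X.ρ ⟨j, 1⟩ ≠ 0 := (ha _).2 ((hB.leJ_iff hM hj).2 ⟨hj, φ a, 1, by simp [hB.map_one]⟩)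
    -- The kernel is invariant because `(j, 1)` is central; an injective idempotent operator is the
    -- identity.
    have hker : (X.ρ ⟨j, 1⟩).ker = ⊥ := by
      refine (((isIrreducible_iff X.ρ).1 X.irreducible).2 _ fun ⟨k, b⟩ v hv => ?_).resolve_right
        fun h => h1 (LinearMap.ker_eq_top.1 h)
      rw [LinearMap.mem_ker] at hv ⊢
      rw [← Module.End.mul_apply, hmul, ← hmul', Module.End.mul_apply, hv, map_zero]
    ext v
    apply LinearMap.ker_eq_bot.1 hker
    rw [← Module.End.mul_apply, hmul, hj, Module.End.one_apply]
  have hact : ∀ k b, X.ρ ⟨k, b⟩ = if j + k = j then X.ρ ⟨j, b⟩ else 0 := by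
    intro k b
    split_ifs with hk
    · rw [← one_mul (X.ρ _), ← hone, hmul, hk]
    · by_contra h
      exact hk (hne k b h)
  choose! ψ hψ using fun (b : B) (hb : b ∉ Z) => (hB.mem_or b).resolve_left hb
  have hψφ : ∀ s, ψ (φ s) = s := fun s => (hB.injective (hψ _ (hB.notMem s))).symm
  let op : B → Module.End K X.V := fun b => if b ∈ Z then 0 else X.ρ ⟨j, ψ b⟩
  have hopZ : ∀ b ∈ Z, op b = 0 := fun b hb => if_pos hb
  have hop : ∀ s, op (φ s) = X.ρ ⟨j, s⟩ := fun s => by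
    simp only [op, if_neg (hB.notMem s), hψφ]
  let σ : Representation K B X.V :=
    { toFun := op
      map_one' := by rw [← hB.map_one, hop, hone]
      map_mul' := by
        intro b c
        by_cases hb : b ∈ Z
        · rw [hopZ _ hb, hopZ _ (hB.mul_mem_right _ hb c), zero_mul]
        by_cases hc : c ∈ Z
        · rw [hopZ _ hc, hopZ _ (hB.mul_mem_left _ hc b), mul_zero]
        rw [hψ b hb, hψ c hc, hop, hop, ← map_mul, TwistedProduct.mk_mul_mk, hj]
        by_cases h : j + t.Φ (ψ b) (ψ c) • q = j
        · rw [← hB.map_mul _ _ h, h, hop]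
        -- Both sides vanish: the product lies in `Z`, and its first coordinate is not absorbed by
        -- `j`.
        · rw [hopZ _ (hB.mul_mem _ _ h), hact, if_neg]
          rwa [← add_assoc, hj] }
  have hσ : σ.IsIrreducible := by
    refine isIrreducible_of_operators X.irreducible σ fun ⟨k, b⟩ => ?_
    by_cases hk : j + k = j
    · exact .inr ⟨φ b, by rw [hact, if_pos hk]; exact hop b⟩
    · exact .inl (by rw [hact, if_neg hk])
  refine ⟨⟨X.V, σ, hσ⟩, hopZ, LinearEquiv.refl K X.V, fun k b v => ?_⟩
  change X.ρ ⟨k, b⟩ v = if j + k = j then op (φ b) v else 0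
  rw [hop, hact]
  split_ifs <;> rfl

/-- Inflation is multiplicative because `j` absorbs a sum only if it absorbs each summand, and a
product whose twist is not absorbed lies in `Z`, which acts as zero. -/
theorem exists_layerRel_of_map_eq_zero (hB : IsLayerMonoid t q j φ Z)
    (hM : DTrivial (Multiplicative M)) (hj : j + j = j) {Y : Irrep K B}
    (hY : ∀ z ∈ Z, Y.ρ z = 0) :
    ∃ X : Irrep K (TwistedProduct t q), LayerRel j φ Z X Y := by
  classical
  let ρ : Representation K (TwistedProduct t q) Y.V :=
    { toFun := fun x => if j + x.fst = j then Y.ρ (φ x.snd) else 0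
      map_one' := by
        rw [TwistedProduct.one_def, if_pos (add_zero j), hB.map_one, map_one]
      map_mul' := by
        rintro ⟨k, a⟩ ⟨l, b⟩
        simp only [TwistedProduct.mk_mul_mk]
        by_cases hk : j + k = j
        · by_cases hl : j + l = j
          · have h1 : j + (k + l + t.Φ a b • q) = j + t.Φ a b • q := by
              rw [← add_assoc, ← add_assoc, hk, hl]
            rw [if_pos hk, if_pos hl, h1, ← map_mul]
            split_ifs with h
            · rw [hB.map_mul _ _ h]
            · rw [hY _ (hB.mul_mem _ _ h)]
          · rw [if_neg hl, mul_zero, if_neg]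
            exact fun h => hl (add_eq_self_of_add_add_eq_self hM (t := k + t.Φ a b • q)
              (by rwa [← add_assoc l, add_comm l]))
        · rw [if_neg hk, zero_mul, if_neg]
          exact fun h => hk (add_eq_self_of_add_add_eq_self hM (t := l + t.Φ a b • q)
            (by rwa [← add_assoc k l])) }
  have hρ : ∀ k b, ρ ⟨k, b⟩ = if j + k = j then Y.ρ (φ b) else 0 := fun _ _ => rfl
  have hirr : ρ.IsIrreducible := by
    refine isIrreducible_of_operators Y.irreducible ρ fun b => ?_
    rcases hB.mem_or b with hb | ⟨s, rfl⟩
    · exact .inl (hY b hb)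
    · exact .inr ⟨⟨j, s⟩, by rw [hρ, if_pos hj]⟩
  refine ⟨⟨Y.V, ρ, hirr⟩, hY, LinearEquiv.refl K Y.V, fun k b v => ?_⟩
  change ρ ⟨k, b⟩ v = if j + k = j then Y.ρ (φ b) v else 0
  rw [hρ]
  split_ifs <;> rfl

/-- A correspondence between simple representations that respects isomorphism induces a bijection
of isomorphism classes. -/
theorem exists_equiv_of_rel {A : Type*} {B : Type*} [Monoid A] [Monoid B]
    (R : Irrep K A → Irrep K B → Prop) (P : IrrepClass K A → Prop) (Q : IrrepClass K B → Prop)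
    (hP : ∀ X, P (irrepClass X) → ∃ Y, Q (irrepClass Y) ∧ R X Y)
    (hQ : ∀ Y, Q (irrepClass Y) → ∃ X, P (irrepClass X) ∧ R X Y)
    (hR : ∀ X X' Y Y', R X Y → R X' Y' → (irrepClass X = irrepClass X' ↔
      irrepClass Y = irrepClass Y')) :
    ∃ F : {X // P X} ≃ {Y // Q Y}, ∀ X, ∃ x y, irrepClass x = X.1 ∧ irrepClass y = (F X).1 ∧
      R x y := by
  have h : ∀ X : {X // P X}, ∃ Y : {Y // Q Y}, ∃ x y, irrepClass x = X.1 ∧ irrepClass y = Y.1 ∧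
      R x y := by
    rintro ⟨X, hX⟩
    obtain ⟨x, rfl⟩ := X.exists_rep
    obtain ⟨y, hy, hxy⟩ := hP x hX
    exact ⟨⟨_, hy⟩, x, y, rfl, rfl, hxy⟩
  choose F hF using h
  refine ⟨Equiv.ofBijective F ⟨fun X X' hXX' => ?_, fun ⟨Y, hY⟩ => ?_⟩, hF⟩
  · obtain ⟨x, y, hx, hy, hxy⟩ := hF X
    obtain ⟨x', y', hx', hy', hxy'⟩ := hF X'
    apply Subtype.ext
    rw [← hx, ← hx', hR _ _ _ _ hxy hxy', hy, hy', hXX']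
  · obtain ⟨y, rfl⟩ := Y.exists_rep
    obtain ⟨x, hx, hxy⟩ := hQ y hY
    obtain ⟨x', y', hx', hy', hxy'⟩ := hF ⟨_, hx⟩
    refine ⟨⟨_, hx⟩, Subtype.ext ?_⟩
    rw [← hy', ← hR _ _ _ _ hxy' hxy, hx']

theorem exists_layer_equiv [Finite B] (hB : IsLayerMonoid t q j φ Z)
    (hM : DTrivial (Multiplicative M)) (hj : j + j = j) (Q : IrrepClass K B → Prop)
    (hQ : ∀ Y, Q (irrepClass Y) ↔ ∀ z ∈ Z, Y.ρ z = 0) :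
    ∃ F : {X : IrrepClass K (TwistedProduct t q) // InLayer j X} ≃ {Y // Q Y},
      ∀ X, (F X).1.dim = X.1.dim ∧
        ∀ a : S, X.1.HasApex (jClass ⟨j, a⟩) ↔ (F X).1.HasApex (jClass (φ a)) := by
  have h : ∃ F : {X : IrrepClass K (TwistedProduct t q) // InLayer j X} ≃ {Y // Q Y},
      ∀ X, ∃ x y, irrepClass x = X.1 ∧ irrepClass y = (F X).1 ∧ LayerRel j φ Z x y := by
    refine exists_equiv_of_rel _ _ _ ?_ ?_ fun X X' Y Y' h h' => h.irrepClass_eq_iff hB hj h'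
    · intro X hX
      obtain ⟨Y, hY⟩ := exists_layerRel_of_inLayer hB hM hj hX
      exact ⟨Y, (hQ Y).2 hY.1, hY⟩
    · intro Y hY
      obtain ⟨X, hX⟩ := exists_layerRel_of_map_eq_zero (t := t) (q := q) hB hM hj ((hQ Y).1 hY)
      obtain ⟨b, hb⟩ := exists_apex Y.irreducible
      -- The apex of `Y` acts nontrivially, so it comes from `S`; this places `X` in the layer.
      have hbZ : b ∉ Z := fun h => (hb b).2 (LeJ.refl b) ((hQ Y).1 hY b h)
      obtain ⟨a, rfl⟩ := (hB.mem_or b).resolve_left hbZ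
      exact ⟨X, ⟨a, (hX.hasApex_iff hB hM hj a).2 (IrrepClass.hasApex_iff.2 hb)⟩, hX⟩
  obtain ⟨F, hF⟩ := h
  refine ⟨F, fun X => ?_⟩
  obtain ⟨x, y, hx, hy, h⟩ := hF X
  rw [← hx, ← hy]
  exact ⟨h.dim_eq, h.hasApex_iff hB hM hj⟩

end Layer

end TwistedMonoid

/-! ### The main theorem -/

open TwistedMonoid in
theorem theoremT {K : Type u} [Field K] {S : Type v} [Monoid S] [Finite S]
    (t : Twisting S) [t.IsTight] {M : Type w} [AddCommMonoid M]
    (hM : DTrivial (Multiplicative M)) (q : M)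
    (hcon : ∀ (j : M) (a : S), ExistsImpliesForAll t q j a) :
    -- every layer over an idempotent of `M` looks like `S` or like the 0-twisted monoid
    (∀ j : M, j + j = j →
      ((∀ a : S, (jClass (⟨j, a⟩ : TwistedProduct t q)).IsApex ↔ (jClass a).IsApex) ∧
        ∃ F : {X : IrrepClass K (TwistedProduct t q) // InLayer j X} ≃ IrrepClass K S,
          ∀ X, (F X).dim = X.1.dim ∧
            ∀ a : S, X.1.HasApex (jClass ⟨j, a⟩) ↔ (F X).HasApex (jClass a)) ∨
      ((∀ a : S, (jClass (⟨j, a⟩ : TwistedProduct t q)).IsApex ↔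
            (jClass (ZeroTwisted.of a : ZeroTwisted t)).IsApex) ∧
        ∃ F : {X : IrrepClass K (TwistedProduct t q) // InLayer j X} ≃
            {Y : IrrepClass K (ZeroTwisted t) // ¬ Y.HasApex (jClass 0)},
          ∀ X, (F X).1.dim = X.1.dim ∧
            ∀ a : S, X.1.HasApex (jClass ⟨j, a⟩) ↔
              (F X).1.HasApex (jClass (ZeroTwisted.of a)))) ∧
    -- only idempotents of `M` carry apexes or simple modules
    (∀ (j : M) (a : S), (jClass (⟨j, a⟩ : TwistedProduct t q)).IsApex → j + j = j) ∧
    (∀ (j : M) (X : IrrepClass K (TwistedProduct t q)), InLayer j X → j + j = j) ∧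
    -- every simple module of a finite twisted product lies in exactly one layer
    (Finite M → ∀ X : IrrepClass K (TwistedProduct t q), ∃! j : M, InLayer j X) ∧
    -- for trivial `H`-classes the simple modules are indexed by the apexes
    (HTrivial S →
      IndexedByApexes K S ∧ IndexedByApexes K (ZeroTwisted t) ∧
        (Finite M → IndexedByApexes K (TwistedProduct t q))) := by
  refine ⟨fun j hj => ?_, fun j a => TwistedProduct.add_self_of_isApex hM,
    fun j X => InLayer.add_self hM, fun _ X => ?_, fun hS =>
      ⟨indexedByApexes_of_hTrivial K hS, indexedByApexes_of_hTrivial K (ZeroTwisted.hTrivial hS),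
        fun _ => indexedByApexes_of_hTrivial K (TwistedProduct.hTrivial hM hS)⟩⟩
  -- Whether `j` absorbs `q` decides between `S` and the 0-twisted monoid.
  · by_cases hq : j + q = j
    · have hB := isLayerMonoid_self (t := t) hq
      refine .inl ⟨hB.isApex_iff hM hj, ?_⟩
      obtain ⟨F, hF⟩ := exists_layer_equiv (K := K) hB hM hj (fun _ => True) (by simp)
      exact ⟨F.trans (Equiv.subtypeUnivEquiv fun _ => trivial), hF⟩
    · have hB := isLayerMonoid_zeroTwisted (t := t) hM hq
      exact .inr ⟨hB.isApex_iff hM hj, exists_layer_equiv hB hM hj _ fun Y => by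
        rw [not_hasApex_zero_iff]; simp⟩
  · obtain ⟨j, hj⟩ := exists_inLayer X
    exact ⟨j, hj, fun k hk => InLayer.unique hM hk hj⟩
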